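/- Let $S_A$ and $S_B$ be random variables, uniformly distributed on $[0,a]$ and $[0,b]$ respectively ($a,b>0$), with means $\alpha_A$ and $\alpha_B$ (so $a=2\alpha_A$, $b=2\alpha_B$) and distribution functions $G_A$ and $G_B$, and suppose $\alpha_B<\alpha_A$. Let $\lambda_A,\lambda_B,p$ be real numbers and $m_A,m_B$ real functions. (In the model, $S_A,S_B$ are the service times at nodes A and B of a network of infinite-server nodes that is empty at time $0$; $\lambda_A,\lambda_B$ are the rates of the external Poisson arrivals at the nodes, $p$ is the probability of going from A to B, and $m_A(t),m_B(t)$ are the mean unitary contribution and pension.) For real $t$ put $$n_A(t)=\lambda_A\int_0^t(1-G_A(v))\,dv,\qquad n_B(t)=\int_0^t\bigl(p\lambda_AG_A(v)+\lambda_B\bigr)\bigl(1-G_B(t-v)\bigr)\,dv .$$ The fund is in equilibrium at time $t$ when $m_A(t)\,n_A(t)=m_B(t)\,n_B(t)$, that is, when $$m_A(t)\lambda_A\int_0^t(1-G_A(v))\,dv=m_B(t)\int_0^t\bigl(p\lambda_AG_A(v)+\lambda_B\bigr)\bigl(1-G_B(t-v)\bigr)\,dv .\tag{2}$$ i) If $0\le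 \frac t2<\alpha_B$, then $n_A(t)=\lambda_A\left(t-\frac{t^2}{4\alpha_A}\right)$ and $n_B(t)=\lambda_B\left(t-\frac{t^2}{4\alpha_B}\right)+p\lambda_A\left(\frac{t^2}{4\alpha_A}-\frac{t^3}{24\alpha_A\alpha_B}\right)$, and (2) holds if and only if $$m_A(t)\lambda_A\left(t-\frac{t^2}{4\alpha_A}\right)=m_B(t)\lambda_B\left(t-\frac{t^2}{4\alpha_B}\right)+m_B(t)p\lambda_A\left(\frac{t^2}{4\alpha_A}-\frac{t^3}{24\alpha_A\alpha_B}\right).$$ ii) If $\alpha_B\le\frac t2<\alpha_A$, then $n_A(t)=\lambda_A\left(t-\frac{t^2}{4\alpha_A}\right)$ and $n_B(t)=\lambda_B\alpha_B+p\lambda_A\left(-\frac{\alpha_B^2}{3\alpha_A}+\frac{t\alpha_B}{2\alpha_A}\right)$, and (2) holds if and only if $$m_A(t)\lambda_A\left(t-\frac{t^2}{4\alpha_A}\right)=m_B(t)\lambda_B\alpha_B+m_B(t)p\lambda_A\left(-\frac{\alpha_B^2}{3\alpha_A}+\frac{t\alpha_B}{2\alpha_A}\right).$$ iii) If $\alpha_A\le\frac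 t2<\alpha_A+\alpha_B$, then $n_A(t)=\lambda_A\alpha_A$ and $n_B(t)=\lambda_B\alpha_B+p\lambda_A\left(-\alpha_A-\frac{\alpha_A^2}{12\alpha_B}+t-\frac{(t-\alpha_A)^2}{4\alpha_B}+\frac{(t-2\alpha_B)^3}{24\alpha_A\alpha_B}\right)$, and (2) holds if and only if $$m_A(t)\lambda_A\alpha_A=m_B(t)\lambda_B\alpha_B+m_B(t)p\lambda_A\left(-\alpha_A-\frac{\alpha_A^2}{12\alpha_B}+t-\frac{(t-\alpha_A)^2}{4\alpha_B}+\frac{(t-2\alpha_B)^3}{24\alpha_A\alpha_B}\right).$$ -/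

import Mathlib

/-- The distribution function `v ↦ P(S ≤ v)` of a real random variable `S`. -/
noncomputable def serviceDF {Ω : Type*} [MeasurableSpace Ω] (P : MeasureTheory.Measure Ω)
    (S : Ω → ℝ) (v : ℝ) : ℝ :=
  ProbabilityTheory.cdf (P.map S) v

/-- Mean number of individuals at node A at time `t` for the network that is empty at time `0`:
`λ_A ∫₀ᵗ (1 - G_A(v)) dv`. -/
noncomputable def meanNumberA (lamA : ℝ) (GA : ℝ → ℝ) (t : ℝ) : ℝ :=
  lamA * ∫ v in (0 : ℝ)..t, (1 - GA v)

/-- Mean number of individuals at node B at time `t` for the network that is empty at time `0`: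
`∫₀ᵗ (p λ_A G_A(v) + λ_B) (1 - G_B(t - v)) dv`. -/
noncomputable def meanNumberB (lamA lamB p : ℝ) (GA GB : ℝ → ℝ) (t : ℝ) : ℝ :=
  ∫ v in (0 : ℝ)..t, (p * lamA * GA v + lamB) * (1 - GB (t - v))

/-- The fund equilibrium equation at time `t` under Poisson arrivals:
`m_A(t) λ_A ∫₀ᵗ (1 - G_A(v)) dv = m_B(t) ∫₀ᵗ (p λ_A G_A(v) + λ_B) (1 - G_B(t - v)) dv`. -/
def FundEquilibrium (lamA lamB p : ℝ) (GA GB mA mB : ℝ → ℝ) (t : ℝ) : Prop :=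
  mA t * meanNumberA lamA GA t = mB t * meanNumberB lamA lamB p GA GB t

open MeasureTheory ProbabilityTheory in
/-- The distribution function of the uniform law on `[0, a]`. -/
theorem serviceDF_of_isUniform {Ω : Type*} [MeasurableSpace Ω] {P : Measure Ω}
    [IsProbabilityMeasure P] {S : Ω → ℝ} {a : ℝ} (ha : 0 < a)
    (hS : pdf.IsUniform S (Set.Icc 0 a) P volume) (v : ℝ) :
    serviceDF P S v = max (min a v) 0 / a := by
  have hm : AEMeasurable S P := hS.aemeasurable (by simp [ha]) (by simp)
  have : IsProbabilityMeasure (P.map S) := Measure.isProbabilityMeasure_map hm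
  have hinter : Set.Icc 0 a ∩ Set.Iic v = Set.Icc 0 (min a v) := by
    ext x; simp [and_assoc]
  rw [serviceDF, cdf_eq_real, show P.map S = volume[|Set.Icc 0 a] from hS,
    Measure.real, cond_apply measurableSet_Icc, hinter, ENNReal.toReal_mul, ENNReal.toReal_inv]
  simp only [Real.volume_Icc, sub_zero, ENNReal.toReal_ofReal', max_eq_left ha.le]
  ring

open MeasureTheory ProbabilityTheory in
/-- The mean of the uniform law on `[0, a]`. -/
theorem integral_of_isUniform_Icc_zero {Ω : Type*} [MeasurableSpace Ω] {P : Measure Ω}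
    {S : Ω → ℝ} {a : ℝ} (ha : 0 < a)
    (hS : pdf.IsUniform S (Set.Icc 0 a) P volume) : ∫ ω, S ω ∂P = a / 2 := by
  rw [hS.integral_eq, integral_Icc_eq_integral_Ioc, ← intervalIntegral.integral_of_le ha.le,
    integral_id, Real.volume_Icc, sub_zero, ENNReal.toReal_inv, ENNReal.toReal_ofReal ha.le]
  field_simp
  ring

/-- The clipped linear function `v ↦ max (min a v) 0 / a` is continuous. -/
theorem continuous_uniformDF (a : ℝ) : Continuous fun v : ℝ => max (min a v) 0 / a := by
  fun_prop

theorem uniformDF_of_mem_Icc {a v : ℝ} (h : v ∈ Set.Icc 0 a) : max (min a v) 0 / a = v / a := by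
  rw [min_eq_right h.2, max_eq_left h.1]

theorem uniformDF_of_le {a v : ℝ} (ha : 0 < a) (h : a ≤ v) : max (min a v) 0 / a = 1 := by
  rw [min_eq_left h, max_eq_left ha.le, div_self ha.ne']

theorem integral_one_sub_div (a x y : ℝ) :
    ∫ v in x..y, (1 - v / a) = (y - y ^ 2 / (2 * a)) - (x - x ^ 2 / (2 * a)) := by
  refine intervalIntegral.integral_eq_sub_of_hasDerivAt (f := fun v => v - v ^ 2 / (2 * a))
    (fun v _ => ?_) (Continuous.intervalIntegrable (by fun_prop) _ _)
  refine ((hasDerivAt_id v).sub ((hasDerivAt_pow 2 v).div_const (2 * a))).congr_deriv ?_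
  norm_num
  ring

theorem integral_linear_mul_one_sub_div (c d t b x y : ℝ) :
    ∫ v in x..y, (c * v + d) * (1 - (t - v) / b) =
      (d * (1 - t / b) * y + (c * (1 - t / b) + d / b) * y ^ 2 / 2 + c / b * y ^ 3 / 3) -
      (d * (1 - t / b) * x + (c * (1 - t / b) + d / b) * x ^ 2 / 2 + c / b * x ^ 3 / 3) := by
  refine intervalIntegral.integral_eq_sub_of_hasDerivAt
    (f := fun v => d * (1 - t / b) * v + (c * (1 - t / b) + d / b) * v ^ 2 / 2 +
      c / b * v ^ 3 / 3)
    (fun v _ => ?_) (Continuous.intervalIntegrable (by fun_prop) _ _)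
  refine ((((hasDerivAt_id v).const_mul (d * (1 - t / b))).add
    (((hasDerivAt_pow 2 v).const_mul (c * (1 - t / b) + d / b)).div_const 2)).add
    (((hasDerivAt_pow 3 v).const_mul (c / b)).div_const 3)).congr_deriv ?_
  norm_num
  ring

section Uniform

variable {a b t : ℝ} {GA GB : ℝ → ℝ}

theorem meanNumberA_uniform_of_le (hGA : ∀ v, GA v = max (min a v) 0 / a) (lamA : ℝ)
    (h0 : 0 ≤ t) (hta : t ≤ a) :
    meanNumberA lamA GA t = lamA * (t - t ^ 2 / (2 * a)) := by
  have h : ∫ v in (0 : ℝ)..t, (1 - GA v) = ∫ v in (0 : ℝ)..t, (1 - v / a) := by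
    refine intervalIntegral.integral_congr fun v hv => ?_
    rw [Set.uIcc_of_le h0] at hv
    simp only [hGA, uniformDF_of_mem_Icc ⟨hv.1, hv.2.trans hta⟩]
  rw [meanNumberA, h, integral_one_sub_div]
  ring

theorem meanNumberA_uniform_of_ge (ha : 0 < a) (hGA : ∀ v, GA v = max (min a v) 0 / a)
    (lamA : ℝ) (hat : a ≤ t) :
    meanNumberA lamA GA t = lamA * (a / 2) := by
  have hc : Continuous fun v => 1 - GA v := by
    rw [funext hGA]; exact continuous_const.sub (continuous_uniformDF a)
  have h1 := meanNumberA_uniform_of_le hGA lamA ha.le le_rfl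
  have h2 : ∫ v in a..t, (1 - GA v) = 0 := by
    refine (intervalIntegral.integral_congr (g := fun _ => (0 : ℝ)) fun v hv => ?_).trans
      intervalIntegral.integral_zero
    rw [Set.uIcc_of_le hat] at hv
    simp only [hGA, uniformDF_of_le ha hv.1, sub_self]
  rw [meanNumberA, ← intervalIntegral.integral_add_adjacent_intervals
    (hc.intervalIntegrable 0 a) (hc.intervalIntegrable a t), h2, add_zero]
  rw [meanNumberA] at h1
  rw [h1]
  field_simp
  ring

/-- The integrand of `meanNumberB` vanishes on the times more than `b` before `t`. -/
theorem integral_meanNumberB_eq_zero (hb : 0 < b) (hGB : ∀ v, GB v = max (min b v) 0 / b)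
    (f : ℝ → ℝ) (hbt : b ≤ t) :
    ∫ v in (0 : ℝ)..(t - b), f v * (1 - GB (t - v)) = 0 := by
  refine (intervalIntegral.integral_congr (g := fun _ => (0 : ℝ)) fun v hv => ?_).trans
    intervalIntegral.integral_zero
  rw [Set.uIcc_of_le (by linarith)] at hv
  simp only [hGB, uniformDF_of_le hb (show b ≤ t - v by linarith [hv.2]), sub_self, mul_zero]

theorem integral_meanNumberB_of_le (hGA : ∀ v, GA v = max (min a v) 0 / a)
    (hGB : ∀ v, GB v = max (min b v) 0 / b) (c d : ℝ) {x y : ℝ}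
    (hx : 0 ≤ x) (hxy : x ≤ y) (hya : y ≤ a) (hyt : y ≤ t) (hxt : t - x ≤ b) :
    ∫ v in x..y, (c * GA v + d) * (1 - GB (t - v)) =
      ∫ v in x..y, (c / a * v + d) * (1 - (t - v) / b) := by
  refine intervalIntegral.integral_congr fun v hv => ?_
  rw [Set.uIcc_of_le hxy] at hv
  simp only [hGA, hGB, uniformDF_of_mem_Icc (a := a) ⟨hx.trans hv.1, hv.2.trans hya⟩,
    uniformDF_of_mem_Icc (a := b) (v := t - v) ⟨by linarith [hv.2], by linarith [hv.1]⟩]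
  ring

theorem integral_meanNumberB_of_ge (ha : 0 < a) (hGA : ∀ v, GA v = max (min a v) 0 / a)
    (hGB : ∀ v, GB v = max (min b v) 0 / b) (c d : ℝ)
    (hat : a ≤ t) (htb : t - a ≤ b) :
    ∫ v in a..t, (c * GA v + d) * (1 - GB (t - v)) =
      ∫ v in a..t, (0 * v + (c + d)) * (1 - (t - v) / b) := by
  refine intervalIntegral.integral_congr fun v hv => ?_
  rw [Set.uIcc_of_le hat] at hv
  simp only [hGA, hGB, uniformDF_of_le ha hv.1,
    uniformDF_of_mem_Icc (a := b) (v := t - v) ⟨by linarith [hv.2], by linarith [hv.1]⟩]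
  ring

theorem meanNumberB_uniform_of_le (ha : 0 < a) (hb : 0 < b)
    (hGA : ∀ v, GA v = max (min a v) 0 / a) (hGB : ∀ v, GB v = max (min b v) 0 / b)
    (lamA lamB p : ℝ) (h0 : 0 ≤ t) (hta : t ≤ a) (htb : t ≤ b) :
    meanNumberB lamA lamB p GA GB t =
      lamB * (t - t ^ 2 / (2 * b)) +
        p * lamA * (t ^ 2 / (2 * a) - t ^ 3 / (6 * a * b)) := by
  rw [meanNumberB, integral_meanNumberB_of_le hGA hGB _ _ le_rfl h0 hta le_rfl (by linarith),
    integral_linear_mul_one_sub_div]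
  field_simp
  ring

theorem continuous_meanNumberB_integrand
    (hGA : ∀ v, GA v = max (min a v) 0 / a) (hGB : ∀ v, GB v = max (min b v) 0 / b)
    (c d t : ℝ) : Continuous fun v => (c * GA v + d) * (1 - GB (t - v)) := by
  have hA : Continuous GA := by rw [funext hGA]; exact continuous_uniformDF a
  have hB : Continuous GB := by rw [funext hGB]; exact continuous_uniformDF b
  fun_prop

theorem meanNumberB_uniform_of_mem (ha : 0 < a) (hb : 0 < b)
    (hGA : ∀ v, GA v = max (min a v) 0 / a) (hGB : ∀ v, GB v = max (min b v) 0 / b)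
    (lamA lamB p : ℝ) (hbt : b ≤ t) (hta : t ≤ a) :
    meanNumberB lamA lamB p GA GB t =
      lamB * (b / 2) + p * lamA * (-(b ^ 2 / (6 * a)) + t * b / (2 * a)) := by
  have hc := continuous_meanNumberB_integrand hGA hGB (p * lamA) lamB t
  rw [meanNumberB, ← intervalIntegral.integral_add_adjacent_intervals
      (hc.intervalIntegrable 0 (t - b)) (hc.intervalIntegrable (t - b) t),
    integral_meanNumberB_eq_zero hb hGB _ hbt,
    integral_meanNumberB_of_le hGA hGB _ _ (by linarith) (by linarith) hta le_rfl (by linarith),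
    integral_linear_mul_one_sub_div]
  field_simp
  ring

theorem meanNumberB_uniform_of_ge (ha : 0 < a) (hb : 0 < b)
    (hGA : ∀ v, GA v = max (min a v) 0 / a) (hGB : ∀ v, GB v = max (min b v) 0 / b)
    (lamA lamB p : ℝ) (hbt : b ≤ t) (hat : a ≤ t) (htab : t ≤ a + b) :
    meanNumberB lamA lamB p GA GB t =
      lamB * (b / 2) + p * lamA * (-(a / 2) - a ^ 2 / (24 * b) + t -
        (t - a / 2) ^ 2 / (2 * b) + (t - b) ^ 3 / (6 * a * b)) := by
  have hc := continuous_meanNumberB_integrand hGA hGB (p * lamA) lamB t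
  rw [meanNumberB, ← intervalIntegral.integral_add_adjacent_intervals
      (hc.intervalIntegrable 0 (t - b)) (hc.intervalIntegrable (t - b) t),
    ← intervalIntegral.integral_add_adjacent_intervals
      (hc.intervalIntegrable (t - b) a) (hc.intervalIntegrable a t),
    integral_meanNumberB_eq_zero hb hGB _ hbt,
    integral_meanNumberB_of_le hGA hGB _ _ (by linarith) (by linarith) le_rfl hat (by linarith),
    integral_meanNumberB_of_ge ha hGA hGB _ _ hat (by linarith),
    integral_linear_mul_one_sub_div, integral_linear_mul_one_sub_div]
  field_simp
  ring

end Uniform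

theorem mainTheorem5 {Ω : Type*} [MeasurableSpace Ω] (P : MeasureTheory.Measure Ω)
    [MeasureTheory.IsProbabilityMeasure P]
    (SA SB : Ω → ℝ) (a b αA αB : ℝ) (ha : 0 < a) (hb : 0 < b)
    (hSA : MeasureTheory.pdf.IsUniform SA (Set.Icc 0 a) P MeasureTheory.volume)
    (hSB : MeasureTheory.pdf.IsUniform SB (Set.Icc 0 b) P MeasureTheory.volume)
    (hαA : ∫ ω, SA ω ∂P = αA) (hαB : ∫ ω, SB ω ∂P = αB) (hlt : αB < αA)
    (lamA lamB p : ℝ) (mA mB : ℝ → ℝ) (t : ℝ) :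
    ((0 ≤ t / 2 ∧ t / 2 < αB) →
      meanNumberA lamA (serviceDF P SA) t = lamA * (t - t ^ 2 / (4 * αA)) ∧
      meanNumberB lamA lamB p (serviceDF P SA) (serviceDF P SB) t =
        lamB * (t - t ^ 2 / (4 * αB)) +
          p * lamA * (t ^ 2 / (4 * αA) - t ^ 3 / (24 * αA * αB)) ∧
      (FundEquilibrium lamA lamB p (serviceDF P SA) (serviceDF P SB) mA mB t ↔
        mA t * lamA * (t - t ^ 2 / (4 * αA)) =
          mB t * lamB * (t - t ^ 2 / (4 * αB)) +
            mB t * p * lamA * (t ^ 2 / (4 * αA) - t ^ 3 / (24 * αA * αB)))) ∧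
    ((αB ≤ t / 2 ∧ t / 2 < αA) →
      meanNumberA lamA (serviceDF P SA) t = lamA * (t - t ^ 2 / (4 * αA)) ∧
      meanNumberB lamA lamB p (serviceDF P SA) (serviceDF P SB) t =
        lamB * αB + p * lamA * (-(αB ^ 2 / (3 * αA)) + t * αB / (2 * αA)) ∧
      (FundEquilibrium lamA lamB p (serviceDF P SA) (serviceDF P SB) mA mB t ↔
        mA t * lamA * (t - t ^ 2 / (4 * αA)) =
          mB t * lamB * αB +
            mB t * p * lamA * (-(αB ^ 2 / (3 * αA)) + t * αB / (2 * αA)))) ∧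
    ((αA ≤ t / 2 ∧ t / 2 < αA + αB) →
      meanNumberA lamA (serviceDF P SA) t = lamA * αA ∧
      meanNumberB lamA lamB p (serviceDF P SA) (serviceDF P SB) t =
        lamB * αB +
          p * lamA * (-αA - αA ^ 2 / (12 * αB) + t - (t - αA) ^ 2 / (4 * αB) +
            (t - 2 * αB) ^ 3 / (24 * αA * αB)) ∧
      (FundEquilibrium lamA lamB p (serviceDF P SA) (serviceDF P SB) mA mB t ↔
        mA t * lamA * αA =
          mB t * lamB * αB +
            mB t * p * lamA * (-αA - αA ^ 2 / (12 * αB) + t - (t - αA) ^ 2 / (4 * αB) +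
              (t - 2 * αB) ^ 3 / (24 * αA * αB)))) := by
  have hA : a = 2 * αA := by linarith [integral_of_isUniform_Icc_zero ha hSA]
  have hB : b = 2 * αB := by linarith [integral_of_isUniform_Icc_zero hb hSB]
  have hGA := serviceDF_of_isUniform ha hSA
  have hGB := serviceDF_of_isUniform hb hSB
  have hA0 : αA ≠ 0 := by linarith
  have hB0 : αB ≠ 0 := by linarith
  have equilibrium_iff {x y z : ℝ}
      (hx : meanNumberA lamA (serviceDF P SA) t = lamA * x)
      (hy : meanNumberB lamA lamB p (serviceDF P SA) (serviceDF P SB) t =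
        lamB * y + p * lamA * z) :
      FundEquilibrium lamA lamB p (serviceDF P SA) (serviceDF P SB) mA mB t ↔
        mA t * lamA * x = mB t * lamB * y + mB t * p * lamA * z := by
    rw [FundEquilibrium, hx, hy, mul_add]
    simp only [mul_assoc]
  refine ⟨fun ⟨h1, h2⟩ => ?_, fun ⟨h1, h2⟩ => ?_, fun ⟨h1, h2⟩ => ?_⟩
  · have nA : meanNumberA lamA (serviceDF P SA) t = lamA * (t - t ^ 2 / (4 * αA)) := by
      rw [meanNumberA_uniform_of_le hGA lamA (by linarith) (by linarith), hA]
      ring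
    have nB : meanNumberB lamA lamB p (serviceDF P SA) (serviceDF P SB) t =
        lamB * (t - t ^ 2 / (4 * αB)) +
          p * lamA * (t ^ 2 / (4 * αA) - t ^ 3 / (24 * αA * αB)) := by
      rw [meanNumberB_uniform_of_le ha hb hGA hGB lamA lamB p (by linarith) (by linarith)
        (by linarith), hA, hB]
      field_simp
      ring
    exact ⟨nA, nB, equilibrium_iff nA nB⟩
  · have nA : meanNumberA lamA (serviceDF P SA) t = lamA * (t - t ^ 2 / (4 * αA)) := by
      rw [meanNumberA_uniform_of_le hGA lamA (by linarith) (by linarith), hA]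
      ring
    have nB : meanNumberB lamA lamB p (serviceDF P SA) (serviceDF P SB) t =
        lamB * αB + p * lamA * (-(αB ^ 2 / (3 * αA)) + t * αB / (2 * αA)) := by
      rw [meanNumberB_uniform_of_mem ha hb hGA hGB lamA lamB p (by linarith) (by linarith),
        hA, hB]
      field_simp
      ring
    exact ⟨nA, nB, equilibrium_iff nA nB⟩
  · have nA : meanNumberA lamA (serviceDF P SA) t = lamA * αA := by
      rw [meanNumberA_uniform_of_ge ha hGA lamA (by linarith), hA]
      ring
    have nB : meanNumberB lamA lamB p (serviceDF P SA) (serviceDF P SB) t =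
        lamB * αB +
          p * lamA * (-αA - αA ^ 2 / (12 * αB) + t - (t - αA) ^ 2 / (4 * αB) +
            (t - 2 * αB) ^ 3 / (24 * αA * αB)) := by
      rw [meanNumberB_uniform_of_ge ha hb hGA hGB lamA lamB p (by linarith) (by linarith)
        (by linarith), hA, hB]
      field_simp
      ring
    exact ⟨nA, nB, equilibrium_iff nA nB⟩
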